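/- Concepts of the description logic $\mathcal{ALCO}$ are built from infinitely many atomic concepts $A_0,A_1,\dots$ and infinitely many nominals $\{o_0\},\{o_1\},\dots$ by means of negation $\neg C$, conjunction $C\sqcap D$ and universal restrictions $\forall r.C$, where $r$ ranges over infinitely many role names $r_0,r_1,\dots$ (the other Boolean connectives and $\exists r.C$ are abbreviations). An interpretation consists of a nonempty domain $\Delta$, a subset of $\Delta$ for every atomic concept, a binary relation on $\Delta$ for every role name, and a singleton subset of $\Delta$ for every nominal; the Boolean connectives are interpreted by the corresponding set operations on $\Delta$, and $\forall r.C$ is the set of all $x\in\Delta$ such that every $y$ with $x\,r\,y$ belongs to $C$. Two concepts are equivalent if they denote the same set in every interpretation. A substitution $\sigma$ maps every atomic concept to a (possibly complex) $\mathcal{ALCO}$-concept; $\sigma(C)$ is obtained from $C$ by replacing the atomic concepts accordingly, leaving nominals and role names intact. Theorem. The concept unification problem for $\mathcal{ALCO}$ is undecidable: there is no algorithm that decides, given two $\mathcal{ALCO}$-concepts $C_1$ and $C_2$, whether there exists a substitution $\sigma$ such that $\sigma(C_1)$ is equivalent to $\sigma(C_2)$. -/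

import Mathlib

universe u

namespace ALCO

/-- Concepts of the description logic `ALCO`, over countably infinite, pairwise disjoint supplies
of atomic concepts, nominals and role names, each supply being indexed by `ℕ`. The constructors
are the Boolean connectives `¬` and `⊓`, the universal restriction `∀ r. C`, and nominals `{o}`.
The other connectives (`⊤`, `⊥`, `⊔`, `∃ r. C`) are definable abbreviations. -/
inductive Concept : Type
  | atom (i : ℕ) : Concept
  | nominal (o : ℕ) : Concept
  | neg (C : Concept) : Concept
  | inter (C D : Concept) : Concept
  | all (r : ℕ) (C : Concept) : Concept

namespace Concept

/-- The Gödel number of a concept. -/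
def encode : Concept → ℕ
  | atom i => 5 * i
  | nominal o => 5 * o + 1
  | neg C => 5 * encode C + 2
  | inter C D => 5 * Nat.pair (encode C) (encode D) + 3
  | all r C => 5 * Nat.pair r (encode C) + 4

/-- The concept with a given Gödel number. -/
def decode (n : ℕ) : Concept :=
  if n % 5 = 0 then atom (n / 5)
  else if n % 5 = 1 then nominal (n / 5)
  else if _h : n % 5 = 2 then neg (decode (n / 5))
  else if _h : n % 5 = 3 then
    inter (decode (Nat.unpair (n / 5)).1) (decode (Nat.unpair (n / 5)).2)
  else all (Nat.unpair (n / 5)).1 (decode (Nat.unpair (n / 5)).2)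
termination_by n
decreasing_by
  · omega
  · have := Nat.unpair_left_le (n / 5); omega
  · have := Nat.unpair_right_le (n / 5); omega
  · have := Nat.unpair_right_le (n / 5); omega

theorem decode_encode (C : Concept) : decode (encode C) = C := by
  induction C with
  | atom i => rw [decode]; simp [encode]
  | nominal o =>
    rw [decode, encode]
    have h1 : (5 * o + 1) % 5 = 1 := by omega
    have h2 : (5 * o + 1) / 5 = o := by omega
    simp [h1, h2]
  | neg C ih =>
    rw [decode, encode]
    have h1 : (5 * encode C + 2) % 5 = 2 := by omega
    have h2 : (5 * encode C + 2) / 5 = encode C := by omega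
    simp [h1, h2, ih]
  | inter C D ihC ihD =>
    rw [decode, encode]
    generalize hk : Nat.pair (encode C) (encode D) = k
    have h1 : (5 * k + 3) % 5 = 3 := by omega
    have h2 : (5 * k + 3) / 5 = k := by omega
    simp only [h1, h2]
    simp [← hk, ihC, ihD]
  | all r C ih =>
    rw [decode, encode]
    generalize hk : Nat.pair r (encode C) = k
    have h1 : (5 * k + 4) % 5 = 4 := by omega
    have h2 : (5 * k + 4) / 5 = k := by omega
    simp only [h1, h2]
    simp [← hk, ih]

theorem encode_decode (n : ℕ) : encode (decode n) = n := by
  induction n using Nat.strong_induction_on with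
  | _ n ih =>
    have hl := Nat.unpair_left_le (n / 5)
    have hr := Nat.unpair_right_le (n / 5)
    rw [decode]
    split_ifs with h0 h1 h2 h3
    · simp only [encode]; omega
    · simp only [encode]; omega
    · simp only [encode]; rw [ih _ (by omega)]; omega
    · simp only [encode]; rw [ih _ (by omega), ih _ (by omega), Nat.pair_unpair]; omega
    · simp only [encode]; rw [ih _ (by omega), Nat.pair_unpair]; omega

/-- Gödel numbering is a bijection between concepts and natural numbers. -/
def equivNat : Concept ≃ ℕ where
  toFun := encode
  invFun := decode
  left_inv := decode_encode
  right_inv := encode_decode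

/-- Concepts as inputs of algorithms: computability is with respect to the Gödel numbering. -/
instance instPrimcodable : Primcodable Concept := Primcodable.ofEquiv ℕ equivNat

/-- The result of simultaneously replacing every atomic concept `i` by the concept `σ i`.
Nominals are left intact. -/
def subst (σ : ℕ → Concept) : Concept → Concept
  | atom i => σ i
  | nominal o => nominal o
  | neg C => neg (subst σ C)
  | inter C D => inter (subst σ C) (subst σ D)
  | all r C => all r (subst σ C)

end Concept

/-- An interpretation: a nonempty domain, a subset of it for every atomic concept, a binary
relation on it for every role name, and an element of it for every nominal. Different nominals
may denote the same element. -/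
structure Interpretation where
  Domain : Type u
  nonempty : Nonempty Domain
  atom : ℕ → Set Domain
  role : ℕ → Domain → Domain → Prop
  nominal : ℕ → Domain

/-- The extension of a concept in an interpretation. -/
def Interpretation.ext (I : Interpretation.{u}) : Concept → Set I.Domain
  | .atom i => I.atom i
  | .nominal o => {I.nominal o}
  | .neg C => (I.ext C)ᶜ
  | .inter C D => I.ext C ∩ I.ext D
  | .all r C => {x | ∀ y, I.role r x y → y ∈ I.ext C}

/-- Two concepts are equivalent if they have the same extension in every interpretation. -/
def Equivalent (C D : Concept) : Prop :=
  ∀ I : Interpretation.{u}, I.ext C = I.ext D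

/-- Two concepts are unifiable if some substitution of (possibly complex) concepts for atomic
concepts makes them equivalent. -/
def Unifiable (C D : Concept) : Prop :=
  ∃ σ : ℕ → Concept, Equivalent.{u} (C.subst σ) (D.subst σ)

end ALCO

-- The halting problem reduces to reachability between ground terms under rewriting at the root, and
-- that reduces to unifiability with `bot`. `reachConcept` describes an origin, named by nominal
-- `0`, whose role `0` successors include a root of `s` and no root of `t`, and at which every rule
-- `l → r` holds: a successor satisfying `l` yields one satisfying `r`. Rule variables are atomic
-- concepts, hence open to substitution.
--
-- If `s` rewrites to `t`, a unifier is built along the rewriting sequence (`exists_unifier`): the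
-- origin's truths choose which step's matching substitution the variables denote, so some step of
-- the sequence must fail. Every point where a variable is read is linked to the origin by role `1`,
-- so this choice is the same everywhere.
--
-- If `t` is unreachable, take the model of all ground terms whose origin sees exactly the terms
-- reachable from `s`. Left-linearity makes the rules hold there under every substitution, so
-- `reachConcept` is satisfied at the origin and nothing unifies it with `bot`.
--
-- Finally, a left-linear system simulates `Turing.ToPartrec.Code`, reaching `leaf` exactly on
-- halting (`reflTransGen_start_iff`). A fixed universal program makes only a numeral depend on the
-- input.

universe v w

namespace ALCO

open ALCO.Concept

/-! ### Derived connectives and their semantics -/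

/-- Existential restriction. -/
def Concept.ex (r : ℕ) (C : Concept) : Concept := neg (all r (neg C))

/-- The concept denoting the whole domain. -/
def Concept.top : Concept := neg (inter (nominal 0) (neg (nominal 0)))

/-- The concept denoting the empty set. -/
def Concept.bot : Concept := inter (nominal 0) (neg (nominal 0))

/-- Material implication. -/
def Concept.imp (C D : Concept) : Concept := neg (inter C (neg D))

/-- `D` where `B` holds, and `E` elsewhere. -/
def Concept.ite (B D E : Concept) : Concept := inter (imp B D) (imp (neg B) E)

section ext

variable (I : Interpretation.{u}) (x : I.Domain) (C D E : Concept)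

@[simp] theorem mem_ext_nominal (o : ℕ) : x ∈ I.ext (nominal o) ↔ x = I.nominal o := Iff.rfl

@[simp] theorem mem_ext_neg : x ∈ I.ext (neg C) ↔ x ∉ I.ext C := Iff.rfl

@[simp] theorem mem_ext_inter : x ∈ I.ext (inter C D) ↔ x ∈ I.ext C ∧ x ∈ I.ext D := Iff.rfl

@[simp] theorem mem_ext_all (r : ℕ) :
    x ∈ I.ext (all r C) ↔ ∀ y, I.role r x y → y ∈ I.ext C := Iff.rfl

@[simp] theorem mem_ext_ex (r : ℕ) :
    x ∈ I.ext (ex r C) ↔ ∃ y, I.role r x y ∧ y ∈ I.ext C := by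
  simp [Concept.ex]

@[simp] theorem mem_ext_top : x ∈ I.ext top := by simp [Concept.top]

@[simp] theorem notMem_ext_bot : x ∉ I.ext bot := by simp [Concept.bot]

@[simp] theorem mem_ext_imp : x ∈ I.ext (imp C D) ↔ (x ∈ I.ext C → x ∈ I.ext D) := by
  simp [Concept.imp]

theorem mem_ext_ite_pos {B : Concept} (h : x ∈ I.ext B) :
    x ∈ I.ext (ite B D E) ↔ x ∈ I.ext D := by
  simp [Concept.ite, h]

theorem mem_ext_ite_neg {B : Concept} (h : x ∉ I.ext B) :
    x ∈ I.ext (ite B D E) ↔ x ∈ I.ext E := by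
  simp [Concept.ite, h]

end ext

/-! ### Binary terms -/

/-- Terms over one constant and one binary function symbol, with variables in `V`. -/
inductive Term (V : Type v) : Type v
  | var (i : V) : Term V
  | leaf : Term V
  | node (a b : Term V) : Term V

/-- Ground terms. -/
abbrev Tree : Type v := Term PEmpty.{v + 1}

namespace Term

variable {V : Type v}

/-- Replacing the variables of a term by ground terms. -/
def inst (τ : V → Tree.{u}) : Term V → Tree.{u}
  | var i => τ i
  | leaf => leaf
  | node a b => node (a.inst τ) (b.inst τ)

/-- The list of occurrences of variables in a term. -/
def vars : Term V → List V
  | var i => [i]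
  | leaf => []
  | node a b => a.vars ++ b.vars

theorem inst_congr {τ τ' : V → Tree.{u}} :
    ∀ {t : Term V}, (∀ i ∈ t.vars, τ i = τ' i) → t.inst τ = t.inst τ'
  | var i, h => h i (by simp [vars])
  | leaf, _ => rfl
  | node a b, h => by
    simp only [inst, node.injEq]
    exact ⟨inst_congr fun i hi => h i (by simp [vars, hi]),
      inst_congr fun i hi => h i (by simp [vars, hi])⟩

/-- The concept stating that there is a role `1` successor denoted by the nominal `0`. -/
def linked : Concept := ex 1 (nominal 0)

/-- The concept describing the points at which the given term is rooted, where the roles `2` and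
`3` lead to the immediate subterms and variables stand for the given concepts. -/
def toConcept (P : V → Concept) : Term V → Concept
  | var i => inter linked (P i)
  | leaf => inter linked (neg (ex 2 top))
  | node a b => inter linked (inter (ex 2 (a.toConcept P)) (ex 3 (b.toConcept P)))

/-- The concept describing the points at which the given ground term is rooted. -/
def rooted : Tree.{v} → Concept := toConcept PEmpty.elim

theorem subst_toConcept (σ : ℕ → Concept) (P : V → Concept) :
    ∀ t : Term V, (t.toConcept P).subst σ = t.toConcept fun i => (P i).subst σ
  | var i => rfl
  | leaf => rfl
  | node a b => by
    have ha := subst_toConcept σ P a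
    have hb := subst_toConcept σ P b
    simp only [toConcept, subst, ex, linked, ha, hb]

theorem subst_rooted (σ : ℕ → Concept) (t : Tree.{v}) : t.rooted.subst σ = t.rooted := by
  rw [rooted, subst_toConcept]
  congr
  exact Subsingleton.elim _ _

theorem mem_ext_linked_of_toConcept {I : Interpretation.{u}} {x : I.Domain} {P : V → Concept}
    {t : Term V} (h : x ∈ I.ext (t.toConcept P)) : x ∈ I.ext linked := by
  cases t <;> exact h.1

/-- Variables occur only in conjunction with `linked`, so their values at unlinked points are
irrelevant. -/
theorem mem_ext_toConcept_congr {I : Interpretation.{u}} {P Q : V → Concept}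
    (h : ∀ x ∈ I.ext linked, ∀ i, x ∈ I.ext (P i) ↔ x ∈ I.ext (Q i)) :
    ∀ (t : Term V) (x : I.Domain), x ∈ I.ext (t.toConcept P) ↔ x ∈ I.ext (t.toConcept Q)
  | var i, x => and_congr_right fun hx => h x hx i
  | leaf, _ => Iff.rfl
  | node a b, x => by
    simp [toConcept, mem_ext_toConcept_congr h a, mem_ext_toConcept_congr h b]

theorem mem_ext_rooted_inst {I : Interpretation.{u}} (τ : V → Tree.{w}) :
    ∀ (t : Term V) (x : I.Domain),
      x ∈ I.ext (t.toConcept fun i => (τ i).rooted) ↔ x ∈ I.ext (t.inst τ).rooted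
  | var i, x => ⟨fun h => h.2, fun h => ⟨mem_ext_linked_of_toConcept h, h⟩⟩
  | leaf, _ => Iff.rfl
  | node a b, x => by
    have ha := mem_ext_rooted_inst (I := I) τ a
    have hb := mem_ext_rooted_inst (I := I) τ b
    simp only [rooted] at ha hb
    simp [toConcept, inst, rooted, ha, hb]

end Term

open Term

/-! ### Rewriting at the root as a unification problem -/

/-- A rewriting rule, as a pair of a left-hand side and a right-hand side. -/
abbrev Rule : Type := Term ℕ × Term ℕ

/-- One step of rewriting at the root. -/
def Step (rules : List Rule) (s t : Tree.{v}) : Prop :=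
  ∃ ρ ∈ rules, ∃ τ : ℕ → Tree.{v}, s = ρ.1.inst τ ∧ t = ρ.2.inst τ

/-- No variable occurs twice on the left-hand side, and all variables of the right-hand side occur
on the left-hand side. -/
def Rule.Linear (ρ : Rule) : Prop := ρ.1.vars.Nodup ∧ ∀ i ∈ ρ.2.vars, i ∈ ρ.1.vars

/-- If the left-hand side of a rule is rooted at some role `0` successor, then so is the right-hand
side. -/
def Rule.toConcept (P : ℕ → Concept) (ρ : Rule) : Concept :=
  imp (ex 0 (ρ.1.toConcept P)) (ex 0 (ρ.2.toConcept P))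

/-- The intersection of a list of concepts. -/
def Concept.conj : List Concept → Concept
  | [] => top
  | C :: Cs => inter C (conj Cs)

theorem mem_ext_conj {I : Interpretation.{u}} {x : I.Domain} :
    ∀ {Cs : List Concept}, x ∈ I.ext (conj Cs) ↔ ∀ C ∈ Cs, x ∈ I.ext C
  | [] => by simp [conj]
  | C :: Cs => by simp [conj, mem_ext_conj (Cs := Cs)]

theorem subst_conj (σ : ℕ → Concept) :
    ∀ Cs : List Concept, (conj Cs).subst σ = conj (Cs.map (subst σ))
  | [] => rfl
  | C :: Cs => by simp [conj, subst, subst_conj σ Cs]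

/-- At the point named by the nominal `0`, the rules hold, and the term `t` is not rooted at any
role `0` successor. -/
def stuck (rules : List Rule) (P : ℕ → Concept) (t : Tree.{v}) : Concept :=
  inter (nominal 0) (inter (conj (rules.map (Rule.toConcept P))) (neg (ex 0 t.rooted)))

/-- The concept which is unifiable with the empty one if and only if `s` rewrites to `t`. -/
def reachConcept (rules : List Rule) (s t : Tree.{v}) : Concept :=
  inter (stuck rules atom t) (ex 0 s.rooted)

theorem subst_reachConcept (rules : List Rule) (s t : Tree.{v}) (σ : ℕ → Concept) :
    (reachConcept rules s t).subst σ = inter (stuck rules σ t) (ex 0 s.rooted) := by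
  have h (ρ : Rule) : (ρ.toConcept atom).subst σ = ρ.toConcept σ := by
    simp [Rule.toConcept, imp, ex, subst, subst_toConcept]
  simp [reachConcept, stuck, subst, ex, subst_rooted, subst_conj, Function.comp_def, h]

theorem mem_ext_stuck {rules : List Rule} {P : ℕ → Concept} {t : Tree.{v}}
    {I : Interpretation.{u}} {x : I.Domain} :
    x ∈ I.ext (stuck rules P t) ↔ x = I.nominal 0 ∧
      (∀ ρ ∈ rules, (∃ y, I.role 0 x y ∧ y ∈ I.ext (ρ.1.toConcept P)) →
        ∃ y, I.role 0 x y ∧ y ∈ I.ext (ρ.2.toConcept P)) ∧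
      ∀ y, I.role 0 x y → y ∉ I.ext t.rooted := by
  simp only [stuck, mem_ext_inter, mem_ext_nominal, mem_ext_conj, List.forall_mem_map,
    Rule.toConcept, mem_ext_imp, mem_ext_ex, mem_ext_neg, not_exists, not_and]

/-- The truth value of a concept at the nominal `0`, as seen from the points linked to it. -/
def atOrigin (C : Concept) : Concept := ex 1 (inter (nominal 0) C)

/-- The nominal makes the origin unique, so all linked points agree on what is true there. -/
theorem mem_ext_atOrigin {I : Interpretation.{u}} {x : I.Domain} (hx : x ∈ I.ext linked)
    (C : Concept) : x ∈ I.ext (atOrigin C) ↔ I.nominal 0 ∈ I.ext C := by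
  simp only [linked, mem_ext_ex, mem_ext_nominal] at hx
  obtain ⟨y, hxy, rfl⟩ := hx
  simp only [atOrigin, mem_ext_ex, mem_ext_inter, mem_ext_nominal]
  exact ⟨fun ⟨y, _, hy, h⟩ => hy ▸ h, fun h => ⟨_, hxy, rfl, h⟩⟩

theorem mem_ext_stuck_congr {rules : List Rule} {P Q : ℕ → Concept} {t : Tree.{v}}
    {I : Interpretation.{u}} {x : I.Domain}
    (h : ∀ y ∈ I.ext linked, ∀ i, y ∈ I.ext (P i) ↔ y ∈ I.ext (Q i)) :
    x ∈ I.ext (stuck rules P t) ↔ x ∈ I.ext (stuck rules Q t) := by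
  simp only [mem_ext_stuck, mem_ext_toConcept_congr h]

/-- Induction from the end of the sequence. For `s = t` any substitution works, as `stuck` forbids a
successor rooting `t`. -/
theorem exists_unifier {rules : List Rule} {s t : Tree.{v}}
    (h : Relation.ReflTransGen (Step rules) s t) :
    ∃ P : ℕ → Concept, ∀ (I : Interpretation.{u}) (x : I.Domain),
      x ∈ I.ext (stuck rules P t) → x ∉ I.ext (ex 0 s.rooted) := by
  induction h using Relation.ReflTransGen.head_induction_on with
  | refl =>
    refine ⟨atom, fun I x hx hs => ?_⟩
    obtain ⟨y, hy, hs⟩ := (mem_ext_ex ..).1 hs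
    exact (mem_ext_stuck.1 hx).2.2 y hy hs
  | head hstep _ ih =>
    rename_i s s'
    obtain ⟨P, hP⟩ := ih
    obtain ⟨ρ, hρ, τ, rfl, rfl⟩ := hstep
    -- If the origin already sees the next term, defer to its unifier `P`; otherwise let the
    -- variables denote the matching terms, so that the rule `ρ` forces the next term to be seen, a
    -- contradiction.
    refine ⟨fun i => ite (atOrigin (ex 0 (ρ.2.inst τ).rooted)) (P i) (τ i).rooted,
      fun I x hx hs => ?_⟩
    obtain rfl := (mem_ext_stuck.1 hx).1
    by_cases hs' : I.nominal 0 ∈ I.ext (ex 0 (ρ.2.inst τ).rooted)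
    · refine hP I _ ((mem_ext_stuck_congr fun y hy i => ?_).1 hx) hs'
      exact mem_ext_ite_pos _ _ _ _ ((mem_ext_atOrigin hy _).2 hs')
    · refine hs' ?_
      have hx' := (mem_ext_stuck_congr (Q := fun i => (τ i).rooted) fun y hy i =>
        mem_ext_ite_neg _ _ _ _ (mt (mem_ext_atOrigin hy _).1 hs')).1 hx
      obtain ⟨y, hy, hl⟩ := (mem_ext_ex ..).1 hs
      obtain ⟨z, hz, hr⟩ := (mem_ext_stuck.1 hx').2.1 ρ hρ ⟨y, hy, (mem_ext_rooted_inst ..).2 hl⟩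
      exact (mem_ext_ex ..).2 ⟨z, hz, (mem_ext_rooted_inst ..).1 hr⟩

/-- The interpretation whose points are the ground terms and an origin, from which the terms in
`F` are accessible. -/
def treeModel (F : Set Tree.{u}) : Interpretation.{u} where
  Domain := Option Tree.{u}
  nonempty := ⟨none⟩
  atom _ := ∅
  role
    | 0 => fun x y => x = none ∧ ∃ t ∈ F, y = some t
    | 1 => fun _ y => y = none
    | 2 => fun x y => ∃ a b, x = some (node a b) ∧ y = some a
    | 3 => fun x y => ∃ a b, x = some (node a b) ∧ y = some b
    | _ => fun _ _ => False
  nominal _ := none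

/-- The point of `treeModel F` given by a ground term. -/
def point (F : Set Tree.{u}) (t : Tree.{u}) : (treeModel F).Domain := some t

/-! ### Term concepts in the model of ground terms -/

section treeModel

variable {V : Type v} {F : Set Tree.{u}} {P : V → Concept}

theorem role_two_treeModel {t : Tree.{u}} {y : (treeModel F).Domain} :
    (treeModel F).role 2 (point F t) y ↔ ∃ a b, t = node a b ∧ y = point F a :=
  exists₂_congr fun _ _ => and_congr_left fun _ => Option.some_inj

theorem role_three_treeModel {t : Tree.{u}} {y : (treeModel F).Domain} :
    (treeModel F).role 3 (point F t) y ↔ ∃ a b, t = node a b ∧ y = point F b :=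
  exists₂_congr fun _ _ => and_congr_left fun _ => Option.some_inj

theorem linked_treeModel (x : (treeModel F).Domain) : x ∈ (treeModel F).ext linked :=
  (mem_ext_ex ..).2 ⟨none, rfl, rfl⟩

theorem mem_ext_leaf_treeModel {x : Tree.{u}} :
    point F x ∈ (treeModel F).ext ((leaf : Term V).toConcept P) ↔ x = leaf := by
  simp only [toConcept, mem_ext_inter, mem_ext_neg, mem_ext_ex, mem_ext_top, and_true,
    linked_treeModel, true_and, role_two_treeModel]
  rcases x with ⟨⟨⟩⟩ | _ | _ <;> simp

theorem mem_ext_node_treeModel {x : Tree.{u}} {a b : Term V} :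
    point F x ∈ (treeModel F).ext ((node a b).toConcept P) ↔ ∃ a' b', x = node a' b' ∧
      point F a' ∈ (treeModel F).ext (a.toConcept P) ∧
      point F b' ∈ (treeModel F).ext (b.toConcept P) := by
  simp only [toConcept, mem_ext_inter, mem_ext_ex, linked_treeModel, true_and, role_two_treeModel,
    role_three_treeModel]
  constructor
  · rintro ⟨⟨_, ⟨c, d, rfl, rfl⟩, hc⟩, _, ⟨c', d', h', rfl⟩, hd⟩
    cases h'
    exact ⟨_, _, rfl, hc, hd⟩
  · rintro ⟨c, d, rfl, hc, hd⟩
    exact ⟨⟨_, ⟨c, d, rfl, rfl⟩, hc⟩, _, ⟨c, d, rfl, rfl⟩, hd⟩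

theorem mem_ext_inst_treeModel {τ : V → Tree.{u}} :
    ∀ {l : Term V}, (∀ i ∈ l.vars, point F (τ i) ∈ (treeModel F).ext (P i)) →
      point F (l.inst τ) ∈ (treeModel F).ext (l.toConcept P)
  | var i, h => ⟨linked_treeModel _, h i (by simp [vars])⟩
  | leaf, _ => mem_ext_leaf_treeModel.2 rfl
  | node a b, h => mem_ext_node_treeModel.2 ⟨_, _, rfl,
      mem_ext_inst_treeModel fun i hi => h i (by simp [vars, hi]),
      mem_ext_inst_treeModel fun i hi => h i (by simp [vars, hi])⟩

/-- A variable's concept may contain many terms, so two occurrences could match different subterms;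
linearity excludes this and lets the matchings of both subterms be glued. -/
theorem exists_inst_of_mem_ext_treeModel [DecidableEq V] :
    ∀ {l : Term V} {x : Tree.{u}}, l.vars.Nodup → point F x ∈ (treeModel F).ext (l.toConcept P) →
      ∃ τ : V → Tree.{u}, x = l.inst τ ∧
        ∀ i ∈ l.vars, point F (τ i) ∈ (treeModel F).ext (P i)
  | var i, x, _, h => ⟨fun _ => x, rfl, by simpa [vars] using h.2⟩
  | leaf, _, _, h => ⟨fun _ => leaf, mem_ext_leaf_treeModel.1 h, by simp [vars]⟩
  | node a b, x, hl, h => by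
    obtain ⟨x, y, rfl, hx, hy⟩ := mem_ext_node_treeModel.1 h
    obtain ⟨ha, hb, hab⟩ := List.nodup_append.1 hl
    obtain ⟨τ, rfl, hτ⟩ := exists_inst_of_mem_ext_treeModel ha hx
    obtain ⟨τ', rfl, hτ'⟩ := exists_inst_of_mem_ext_treeModel hb hy
    have hb' (i : V) (hi : i ∈ b.vars) : i ∉ a.vars := fun h => hab i h i hi rfl
    refine ⟨fun i => if i ∈ a.vars then τ i else τ' i, congrArg₂ node
      (inst_congr fun i hi => (if_pos hi).symm) (inst_congr fun i hi => (if_neg (hb' i hi)).symm),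
      fun i hi => ?_⟩
    by_cases hi' : i ∈ a.vars
    · simpa [hi'] using hτ i hi'
    · simpa [hi'] using hτ' i (by simpa [vars, hi'] using hi)

theorem mem_ext_rooted_treeModel : ∀ {t x : Tree.{u}},
    point F x ∈ (treeModel F).ext t.rooted ↔ x = t
  | leaf, _ => mem_ext_leaf_treeModel
  | node a b, x => by
    have ha (y : Tree.{u}) := mem_ext_rooted_treeModel (t := a) (x := y)
    have hb (y : Tree.{u}) := mem_ext_rooted_treeModel (t := b) (x := y)
    simp only [rooted] at ha hb
    rw [rooted, mem_ext_node_treeModel]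
    simp [ha, hb]

end treeModel

theorem unifiable_reachConcept_iff {rules : List Rule} (hrules : ∀ ρ ∈ rules, ρ.Linear)
    {s t : Tree.{u}} :
    Unifiable.{u} (reachConcept rules s t) bot ↔ Relation.ReflTransGen (Step rules) s t := by
  constructor
  · rintro ⟨σ, h⟩
    by_contra hst
    -- This set contains `s`, is closed under the rules and omits `t`.
    let F : Set Tree.{u} := {x | Relation.ReflTransGen (Step rules) s x}
    have hbot : none ∉ (treeModel F).ext ((reachConcept rules s t).subst σ) := by
      rw [h (treeModel F)]
      exact notMem_ext_bot _ _
    rw [subst_reachConcept] at hbot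
    refine hbot ⟨mem_ext_stuck.2 ⟨rfl, fun ρ hρ => ?_, ?_⟩,
      (mem_ext_ex ..).2 ⟨_, ⟨rfl, s, .refl, rfl⟩, mem_ext_rooted_treeModel.2 rfl⟩⟩
    · rintro ⟨_, ⟨-, x, hx, rfl⟩, hl⟩
      obtain ⟨τ, rfl, hτ⟩ := exists_inst_of_mem_ext_treeModel (hrules ρ hρ).1 hl
      exact ⟨_, ⟨rfl, ρ.2.inst τ, hx.tail ⟨ρ, hρ, τ, rfl, rfl⟩, rfl⟩,
        mem_ext_inst_treeModel fun i hi => hτ i ((hrules ρ hρ).2 i hi)⟩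
    · rintro _ ⟨-, x, hx, rfl⟩ hxt
      obtain rfl := mem_ext_rooted_treeModel.1 hxt
      exact hst hx
  · intro h
    obtain ⟨P, hP⟩ := exists_unifier.{u} h
    refine ⟨P, fun I => Set.ext fun x => ?_⟩
    rw [subst_reachConcept]
    exact iff_of_false (fun hx => hP I x hx.1 hx.2) (notMem_ext_bot I x)

end ALCO

open Turing.ToPartrec (Code Cont)

namespace ALCO

open ALCO.Concept Term

/-! ### A rewriting system for the evaluation of programs -/

namespace Term

variable {V : Type v}

/-- The unary representation of a number. -/
def num : ℕ → Term V
  | 0 => leaf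
  | n + 1 => node leaf (num n)

/-- A term with a numerical tag and three arguments. -/
def tagged (n : ℕ) (a b c : Term V) : Term V := node (num n) (node a (node b c))

/-- The state of evaluating the program `c` on the input `x` with continuation `k`. -/
def run (c x k : Term V) : Term V := tagged 0 c x k

/-- The state of passing the value `x` to the continuation `k`. -/
def ret (k x : Term V) : Term V := tagged 1 leaf x k

theorem inst_num (τ : V → Tree.{u}) : ∀ n, (num n).inst τ = num n
  | 0 => rfl
  | n + 1 => congrArg (node leaf) (inst_num τ n)

@[simp] theorem inst_tagged (τ : V → Tree.{u}) (n : ℕ) (a b c : Term V) :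
    (tagged n a b c).inst τ = tagged n (a.inst τ) (b.inst τ) (c.inst τ) := by
  simp [tagged, inst, inst_num]

@[simp] theorem inst_run (τ : V → Tree.{u}) (c x k : Term V) :
    (run c x k).inst τ = run (c.inst τ) (x.inst τ) (k.inst τ) := by
  simp [run]

@[simp] theorem inst_ret (τ : V → Tree.{u}) (k x : Term V) :
    (ret k x).inst τ = ret (k.inst τ) (x.inst τ) := by
  simp [ret, inst]

/-- Lists of numbers as terms. -/
def ofList : List ℕ → Tree.{u}
  | [] => leaf
  | n :: l => node (num n) (ofList l)

/-- Programs as terms. -/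
def ofCode : Code → Tree.{u}
  | .zero' => tagged 0 leaf leaf leaf
  | .succ => tagged 1 leaf leaf leaf
  | .tail => tagged 2 leaf leaf leaf
  | .cons f g => tagged 3 (ofCode f) (ofCode g) leaf
  | .comp f g => tagged 4 (ofCode f) (ofCode g) leaf
  | .case f g => tagged 5 (ofCode f) (ofCode g) leaf
  | .fix f => tagged 6 (ofCode f) leaf leaf

/-- The number represented by a ground term. -/
def toNat : Tree.{u} → ℕ
  | node _ t => t.toNat + 1
  | _ => 0

/-- The list of numbers represented by a ground term. -/
def toList : Tree.{u} → List ℕ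
  | node a t => a.toNat :: t.toList
  | _ => []

/-- The program represented by a ground term. -/
def toCode : Tree.{u} → Code
  | node n (node a (node b _)) =>
    match n.toNat with
    | 0 => .zero'
    | 1 => .succ
    | 2 => .tail
    | 3 => .cons a.toCode b.toCode
    | 4 => .comp a.toCode b.toCode
    | 5 => .case a.toCode b.toCode
    | _ => .fix a.toCode
  | _ => .zero'

/-- The continuation represented by a ground term. -/
def toCont : Tree.{u} → Cont
  | node n (node a (node b c)) =>
    match n.toNat with
    | 0 => .halt
    | 1 => .cons₁ a.toCode b.toList c.toCont
    | 2 => .cons₂ b.toList c.toCont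
    | 3 => .comp a.toCode c.toCont
    | _ => .fix a.toCode c.toCont
  | _ => .halt

/-- The final value of the computation in the state represented by a ground term. -/
def value : Tree.{u} → Part (List ℕ)
  | node n (node c (node x k)) =>
    match n.toNat with
    | 0 => c.toCode.eval x.toList >>= k.toCont.eval
    | _ => k.toCont.eval x.toList
  | _ => pure []

@[simp] theorem toNat_num : ∀ n, (num n : Tree.{u}).toNat = n
  | 0 => rfl
  | n + 1 => congrArg (· + 1) (toNat_num n)

@[simp] theorem toList_ofList : ∀ l, (ofList l : Tree.{u}).toList = l
  | [] => rfl
  | n :: l => by simp [ofList, toList, toList_ofList l]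

@[simp] theorem toCode_ofCode : ∀ c, (ofCode c : Tree.{u}).toCode = c
  | .zero' | .succ | .tail => rfl
  | .cons f g | .comp f g | .case f g => by
    simp [ofCode, tagged, toCode, toCode_ofCode f, toCode_ofCode g]
  | .fix f => by simp [ofCode, tagged, toCode, toCode_ofCode f]

theorem value_run (c x k : Tree.{u}) :
    (run c x k).value = c.toCode.eval x.toList >>= k.toCont.eval := rfl

end Term

/-- The small-step semantics of programs. -/
def evalRules : List Rule :=
  let a : Term ℕ := var 0
  let b : Term ℕ := var 1
  let k : Term ℕ := var 2
  let x : Term ℕ := var 3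
  let y : Term ℕ := var 4
  let z : Term ℕ := var 5
  let nil : Term ℕ := leaf
  let zero : Term ℕ := leaf
  let succ (n : Term ℕ) : Term ℕ := node leaf n
  [(run (tagged 0 nil nil nil) x k, ret k (node zero x)),
    (run (tagged 1 nil nil nil) nil k, ret k (node (succ zero) nil)),
    (run (tagged 1 nil nil nil) (node x y) k, ret k (node (succ x) nil)),
    (run (tagged 2 nil nil nil) nil k, ret k nil),
    (run (tagged 2 nil nil nil) (node x y) k, ret k y),
    (run (tagged 3 a b nil) x k, run a x (tagged 1 b x k)),
    (run (tagged 4 a b nil) x k, run b x (tagged 3 a nil k)),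
    (run (tagged 5 a b nil) nil k, run a nil k),
    (run (tagged 5 a b nil) (node zero y) k, run a y k),
    (run (tagged 5 a b nil) (node (node x y) z) k, run b (node y z) k),
    (run (tagged 6 a nil nil) x k, run a x (tagged 4 a nil k)),
    (ret (tagged 1 b x k) y, run b x (tagged 2 nil y k)),
    (ret (tagged 2 nil nil k) y, ret k (node zero y)),
    (ret (tagged 2 nil (node x z) k) y, ret k (node x y)),
    (ret (tagged 3 a nil k) x, run a x k),
    (ret (tagged 4 a nil k) nil, ret k nil),
    (ret (tagged 4 a nil k) (node zero x), ret k x),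
    (ret (tagged 4 a nil k) (node (node x y) z), run (tagged 6 a nil nil) z k),
    (ret (tagged 0 nil nil nil) x, leaf)]

instance : DecidablePred Rule.Linear := fun ρ =>
  inferInstanceAs (Decidable (ρ.1.vars.Nodup ∧ ∀ i ∈ ρ.2.vars, i ∈ ρ.1.vars))

theorem linear_of_mem_evalRules : ∀ ρ ∈ evalRules, ρ.Linear := by
  decide

/-! ### Correctness of the simulation -/

theorem mem_fix_eval_iff {f : Code} {v w : List ℕ} :
    w ∈ f.fix.eval v ↔ ∃ u ∈ f.eval v,
      (u.headI = 0 ∧ w = u.tail) ∨ (u.headI ≠ 0 ∧ w ∈ f.fix.eval u.tail) := by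
  rw [Code.fix_eval]
  refine PFun.mem_fix_iff.trans ?_
  simp only [Part.mem_map_iff]
  constructor
  · rintro (⟨u, hu, h⟩ | ⟨v', ⟨u, hu, h⟩, hw⟩)
    · refine ⟨u, hu, .inl ?_⟩
      split_ifs at h with h0
      exact ⟨h0, (Sum.inl.inj h).symm⟩
    · refine ⟨u, hu, .inr ?_⟩
      split_ifs at h with h0
      exact ⟨h0, Sum.inr.inj h ▸ hw⟩
  · rintro ⟨u, hu, ⟨h0, rfl⟩ | ⟨h0, hw⟩⟩
    · exact .inl ⟨u, hu, by simp [h0]⟩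
    · exact .inr ⟨_, ⟨u, hu, by simp [h0]⟩, hw⟩

/-- One unfolding of the loop, in the monadic form that matches the evaluation of `Cont.fix`. -/
theorem fix_eval_eq (f : Code) (v : List ℕ) :
    f.fix.eval v = f.eval v >>= fun u => if u.headI = 0 then pure u.tail else f.fix.eval u.tail := by
  refine Part.ext fun w => ?_
  rw [mem_fix_eval_iff, Part.bind_eq_bind, Part.mem_bind_iff]
  refine exists_congr fun u => and_congr_right fun _ => ?_
  split_ifs with h <;> simp [h]

theorem value_cons (f g x k : Tree.{u}) : (run (tagged 3 f g leaf) x k).value =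
    (run f x (tagged 1 g x k)).value := by
  change (Code.cons f.toCode g.toCode).eval x.toList >>= k.toCont.eval = f.toCode.eval x.toList >>=
    fun v => g.toCode.eval x.toList >>= fun ns => k.toCont.eval (v.headI :: ns)
  rw [Code.cons_eval]
  refine (Part.bind_assoc _ _ _).trans (congrArg (Part.bind _) (funext fun v => ?_))
  exact (Part.bind_assoc _ _ _).trans (congrArg (Part.bind _) (funext fun _ => Part.bind_some _ _))

theorem value_fix (f x k : Tree.{u}) : (run (tagged 6 f leaf leaf) x k).value =
    (run f x (tagged 4 f leaf k)).value := by
  change f.toCode.fix.eval x.toList >>= k.toCont.eval = f.toCode.eval x.toList >>=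
    fun v => if v.headI = 0 then k.toCont.eval v.tail else f.toCode.fix.eval v.tail >>= k.toCont.eval
  rw [fix_eval_eq]
  refine (Part.bind_assoc _ _ _).trans (congrArg (Part.bind _) (funext fun v => ?_))
  split_ifs
  · exact Part.bind_some _ _
  · rfl

/-- The decoding functions are total, so this invariant also covers instances by malformed terms. -/
theorem dom_value_inst_iff_of_mem_evalRules (τ : ℕ → Tree.{u}) :
    ∀ ρ ∈ evalRules, (ρ.1.inst τ).value.Dom ↔ (ρ.2.inst τ).value.Dom := by
  simp only [evalRules, List.forall_mem_cons, inst_run, inst_ret, inst_tagged, inst]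
  -- The last rule discards the output, so it preserves only definedness; all others preserve the
  -- value itself.
  refine ⟨?_, ?_, ?_, ?_, ?_, ?_, ?_, ?_, ?_, ?_, ?_, ?_, ?_, ?_, ?_, ?_, ?_, ?_, Iff.rfl,
    fun _ h => (List.not_mem_nil h).elim⟩
  all_goals
    refine iff_of_eq (congrArg Part.Dom ?_)
    first
    | rfl
    | exact Part.bind_some _ _
    | exact Part.bind_assoc _ _ _
    | exact value_cons _ _ _ _
    | exact value_fix _ _ _

theorem dom_value_iff_of_reflTransGen {s t : Tree.{u}}
    (h : Relation.ReflTransGen (Step evalRules) s t) : s.value.Dom ↔ t.value.Dom := by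
  induction h with
  | refl => rfl
  | tail _ h ih =>
    obtain ⟨ρ, hρ, τ, rfl, rfl⟩ := h
    rw [ih, dom_value_inst_iff_of_mem_evalRules τ ρ hρ]

/-- The assignment with the given first six values. -/
def assign (a b k x y z : Tree.{u}) : ℕ → Tree.{u}
  | 0 => a
  | 1 => b
  | 2 => k
  | 3 => x
  | 4 => y
  | _ => z

theorem step_evalRules (i : ℕ) (a b k x y z : Tree.{u}) (hi : i < evalRules.length := by decide) :
    Step evalRules (evalRules[i].1.inst (assign a b k x y z))
      (evalRules[i].2.inst (assign a b k x y z)) :=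
  ⟨_, List.getElem_mem hi, _, rfl, rfl⟩

/-- The continuation is arbitrary because subprograms run under extended continuations. -/
theorem reflTransGen_run {c : Code} {v w : List ℕ} (h : w ∈ c.eval v) (k : Tree.{u}) :
    Relation.ReflTransGen (Step evalRules) (run (ofCode c) (ofList v) k) (ret k (ofList w)) := by
  induction c generalizing v w k with
  | zero' =>
    obtain rfl : w = 0 :: v := by simpa using h
    exact .single (step_evalRules 0 leaf leaf k (ofList v) leaf leaf)
  | succ =>
    obtain rfl : w = [v.headI + 1] := by simpa using h
    rcases v with _ | ⟨n, v⟩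
    · exact .single (step_evalRules 1 leaf leaf k leaf leaf leaf)
    · exact .single (step_evalRules 2 leaf leaf k (num n) (ofList v) leaf)
  | tail =>
    obtain rfl : w = v.tail := by simpa using h
    rcases v with _ | ⟨n, v⟩
    · exact .single (step_evalRules 3 leaf leaf k leaf leaf leaf)
    · exact .single (step_evalRules 4 leaf leaf k (num n) (ofList v) leaf)
  | cons f g ihf ihg =>
    simp only [Code.cons_eval, Part.bind_eq_bind, Part.mem_bind_iff, Part.pure_eq_some,
      Part.mem_some_iff] at h
    obtain ⟨x, hx, y, hy, rfl⟩ := h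
    refine .head (step_evalRules 5 (ofCode f) (ofCode g) k (ofList v) leaf leaf) <|
      (ihf hx _).trans <|
      .head (step_evalRules 11 leaf (ofCode g) k (ofList v) (ofList x) leaf) <|
      (ihg hy _).trans ?_
    rcases x with _ | ⟨n, x⟩
    · exact .single (step_evalRules 12 leaf leaf k leaf (ofList y) leaf)
    · exact .single (step_evalRules 13 leaf leaf k (num n) (ofList y) (ofList x))
  | comp f g ihf ihg =>
    rw [Code.comp_eval] at h
    obtain ⟨x, hx, hw⟩ := Part.mem_bind_iff.1 h
    exact .head (step_evalRules 6 (ofCode f) (ofCode g) k (ofList v) leaf leaf) <|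
      (ihg hx _).trans <|
      .head (step_evalRules 14 (ofCode f) leaf k (ofList x) leaf leaf) (ihf hw _)
  | case f g ihf ihg =>
    rw [Code.case_eval] at h
    rcases v with _ | ⟨_ | n, v⟩
    · exact .head (step_evalRules 7 (ofCode f) (ofCode g) k leaf leaf leaf) (ihf (v := []) h _)
    · exact .head (step_evalRules 8 (ofCode f) (ofCode g) k leaf (ofList v) leaf) (ihf h _)
    · exact .head (step_evalRules 9 (ofCode f) (ofCode g) k leaf (num n) (ofList v))
        (ihg (v := n :: v) h _)
  | fix f ih =>
    -- One pass through the loop body; the head of its result then decides between exit and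
    -- repetition.
    have key := fun v (u : List ℕ) (hu : u ∈ f.eval v) =>
      Relation.ReflTransGen.head
        (step_evalRules 10 (ofCode f) leaf k (ofList v) leaf leaf) (ih hu _)
    rw [Code.fix_eval] at h
    refine PFun.fixInduction' (C := fun v => Relation.ReflTransGen (Step evalRules)
      (run (ofCode f.fix) (ofList v) k) (ret k (ofList w))) h (fun v hv => ?_)
      fun v v' _ hv IH => ?_
    · obtain ⟨u, hu, h⟩ := (Part.mem_map_iff _).1 hv
      split_ifs at h with h0
      obtain rfl := Sum.inl.inj h
      refine (key v u hu).trans ?_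
      rcases u with _ | ⟨_ | n, u⟩
      · exact .single (step_evalRules 15 (ofCode f) leaf k leaf leaf leaf)
      · exact .single (step_evalRules 16 (ofCode f) leaf k (ofList u) leaf leaf)
      · cases h0
    · obtain ⟨u, hu, h⟩ := (Part.mem_map_iff _).1 hv
      split_ifs at h with h0
      obtain rfl := Sum.inr.inj h
      refine (key v u hu).trans ?_
      rcases u with _ | ⟨_ | n, u⟩
      · exact absurd rfl h0
      · exact absurd rfl h0
      · exact .head (step_evalRules 17 (ofCode f) leaf k leaf (num n) (ofList u)) IH

/-- The initial state of evaluating a program on a number. -/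
def start (c : Code) (n : ℕ) : Tree.{u} :=
  run (ofCode c) (ofList [n]) (tagged 0 leaf leaf leaf)

/-- Forward, definedness is invariant and `leaf` has a defined value; backward, the simulation ends
with the halting rule. -/
theorem reflTransGen_start_iff {c : Code} {n : ℕ} :
    Relation.ReflTransGen (Step evalRules) (start c n : Tree.{u}) leaf ↔ (c.eval [n]).Dom := by
  constructor
  · intro h
    have h := dom_value_iff_of_reflTransGen h
    have hs : (start c n : Tree.{u}).value = c.eval [n] := by
      rw [start, value_run, toCode_ofCode, toList_ofList]
      exact bind_pure _
    exact hs ▸ h.2 trivial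
  · intro h
    exact (reflTransGen_run (Part.get_mem h) _).tail
      (step_evalRules 18 leaf leaf leaf (ofList ((c.eval [n]).get h)) leaf leaf)

/-! ### Computability of the reduction -/

theorem primrec_neg : Primrec Concept.neg := by
  have h : Primrec fun C : Concept => equivNat C := Primrec.of_equiv
  refine (Primrec.of_equiv_iff equivNat).1 ?_
  exact Primrec.nat_add.comp (Primrec.nat_mul.comp (.const 5) h) (.const 2)

theorem primrec_inter : Primrec₂ Concept.inter := by
  have h : Primrec fun C : Concept => equivNat C := Primrec.of_equiv
  refine (Primrec.of_equiv_iff equivNat).1 ?_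
  exact Primrec.nat_add.comp (Primrec.nat_mul.comp (.const 5)
    (Primrec₂.natPair.comp (h.comp .fst) (h.comp .snd))) (.const 3)

theorem primrec_all (r : ℕ) : Primrec (Concept.all r) := by
  have h : Primrec fun C : Concept => equivNat C := Primrec.of_equiv
  refine (Primrec.of_equiv_iff equivNat).1 ?_
  exact Primrec.nat_add.comp (Primrec.nat_mul.comp (.const 5)
    (Primrec₂.natPair.comp (.const r) h)) (.const 4)

theorem primrec_ex (r : ℕ) : Primrec (Concept.ex r) :=
  primrec_neg.comp ((primrec_all r).comp primrec_neg)

theorem primrec_rooted_node {f g : ℕ → Tree.{u}} (hf : Primrec fun n => (f n).rooted)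
    (hg : Primrec fun n => (g n).rooted) : Primrec fun n => (node (f n) (g n)).rooted :=
  primrec_inter.comp (.const _)
    (primrec_inter.comp ((primrec_ex 2).comp hf) ((primrec_ex 3).comp hg))

theorem primrec_rooted_num : Primrec fun n => (num n : Tree.{u}).rooted := by
  have h : Primrec fun C : Concept =>
      inter linked (inter (ex 2 (leaf : Tree.{u}).rooted) (ex 3 C)) :=
    primrec_inter.comp (.const _) (primrec_inter.comp (.const _) (primrec_ex 3))
  refine (Primrec.nat_rec₁ (leaf : Tree.{u}).rooted (h.comp Primrec.snd).to₂).of_eq fun n => ?_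
  induction n with
  | zero => rfl
  | succ n ih =>
    simp only at ih ⊢
    rw [ih]
    rfl

/-- With `c` fixed, only the numeral for `n` inside `start` varies. -/
theorem primrec_reachConcept (c : Code) :
    Primrec fun n => reachConcept evalRules (start.{u} c n) (leaf : Tree.{u}) :=
  primrec_inter.comp (.const _) <| (primrec_ex 0).comp <|
    primrec_rooted_node (.const _) <| primrec_rooted_node (.const _) <|
    primrec_rooted_node (primrec_rooted_node primrec_rooted_num (.const _)) (.const _)

end ALCO

theorem theorem4 :
    ¬ ComputablePred (fun p : ALCO.Concept × ALCO.Concept => ALCO.Unifiable.{u} p.1 p.2) := by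
  intro h
  -- The universal function for halting on input `0`; the program `c` below computes it.
  have hf : Nat.Partrec fun n => (Denumerable.ofNat Nat.Partrec.Code n).eval 0 :=
    Partrec.nat_iff.1 <|
      Nat.Partrec.Code.eval_part.comp (Computable.ofNat _) (Computable.const 0)
  obtain ⟨c, hc⟩ := Code.exists_code (Nat.Partrec'.part_iff₁.2 (Partrec.nat_iff.2 hf))
  refine ComputablePred.halting_problem 0 (ComputablePred.computable_of_manyOneReducible
    ⟨fun p => (ALCO.reachConcept ALCO.evalRules (ALCO.start.{u} c (Encodable.encode p))
      (ALCO.Term.leaf : ALCO.Tree.{u}), ALCO.Concept.bot), ?_, fun p => ?_⟩ h)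
  · exact (((ALCO.primrec_reachConcept c).comp Primrec.encode).pair (.const _)).to_comp
  · rw [ALCO.unifiable_reachConcept_iff ALCO.linear_of_mem_evalRules, ALCO.reflTransGen_start_iff]
    have := hc (Encodable.encode p ::ᵥ .nil)
    simp at this
    change c.eval [Encodable.encode p] = _ at this
    rw [this]
    exact Iff.rfl
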